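/- For a finite set $A\subset\mathbb R$ write $E_+(A)=\#\{(a_1,a_2,a_3,a_4)\in A^4: a_1+a_2=a_3+a_4\}$ and $E_\times(A)=\#\{(a_1,a_2,a_3,a_4)\in A^4: a_1a_2=a_3a_4\}$. Call a real number $\beta$ a permissible low-energy decomposition exponent if for every $\varepsilon>0$ there is a $K$ such that every finite set $A\subset\mathbb R$ with $|A|\ge K$ can be written as $A=B\cup C$ with $B$ and $C$ disjoint and $$\max\{E_+(B),E_\times(C)\}\le |A|^{2+\beta+\varepsilon}.$$ **Theorem 1.2.** The set of permissible low-energy decomposition exponents has a (finite) infimum $\kappa$, and $$\tfrac13\le\kappa\le\tfrac{31}{33}.$$ Moreover, for $N\in\mathbb N$, $N\ge 1$, let $$A_N=\{(2m-1)2^n:\ m,n\in\mathbb N,\ 1\le m\le N^{2/3},\ 1\le n\le N^{1/3}\}.$$ Then $|A_N|\to\infty$ as $N\to\infty$, and there is an absolute constant $c>0$ such that for every $N\ge1$ and all disjoint sets $B,C$ with $B\cup C=A_N$ one has $$\max\{E_+(B),E_\times(C)\}\ge c\,|A_N|^{7/3}.$$ -/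

import Mathlib

noncomputable section

namespace LowEnergy

/-- The additive energy `E₊(A)`: the number of quadruples in `A⁴` with `a₁ + a₂ = a₃ + a₄`. -/
def addE (A : Finset ℝ) : ℕ := Finset.addEnergy A A

/-- The multiplicative energy `E_×(A)`: the number of quadruples in `A⁴` with
`a₁ * a₂ = a₃ * a₄`. -/
def mulE (A : Finset ℝ) : ℕ := Finset.mulEnergy A A

/-- `B` and `C` decompose `A`: they are disjoint and have union `A`. -/
def IsDecomposition (A B C : Finset ℝ) : Prop := Disjoint B C ∧ A = B ∪ C

/-- `β` is a permissible low-energy decomposition exponent: for each `ε > 0`, every sufficiently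
large finite set `A` of real numbers has a decomposition `A = B ∪ C` into disjoint sets with
`max {E₊(B), E_×(C)} ≤ |A| ^ (2 + β + ε)`. -/
def Permissible (β : ℝ) : Prop :=
  ∀ ε : ℝ, 0 < ε → ∃ K : ℕ, ∀ A : Finset ℝ, K ≤ A.card →
    ∃ B C : Finset ℝ, IsDecomposition A B C ∧
      max (addE B : ℝ) (mulE C : ℝ) ≤ (A.card : ℝ) ^ (2 + β + ε)

/-- The set of all `(2 m - 1) 2 ^ n` with natural numbers `1 ≤ m ≤ N ^ (2/3)` and
`1 ≤ n ≤ N ^ (1/3)`. -/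
def exampleSet (N : ℕ) : Finset ℝ :=
  (Finset.Icc 1 ⌊(N : ℝ) ^ (2 / 3 : ℝ)⌋₊ ×ˢ Finset.Icc 1 ⌊(N : ℝ) ^ (1 / 3 : ℝ)⌋₊).image
    fun p : ℕ × ℕ => (2 * (p.1 : ℝ) - 1) * 2 ^ p.2

end LowEnergy

end

namespace LowEnergy

open Finset
open scoped Pointwise

/-! Upper bound. Among the subsets C of A avoiding 0 with E_×(C) ≤ θ⁴|C|⁴, take a largest one and
put B = A \ C. The fourth root of E_× is subadditive (`mulEnergy_union_le`), so this class is closed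
under disjoint unions, and by maximality B contains no nonempty member of it. If E_+(B) were large,
Balog–Szemerédi–Gowers (`exists_small_sumset`) would give D ⊆ B with D + D small compared with |D|².
Solymosi's estimate E_× ≪ |D + D|² log|D| (`mulEnergy_le_of_pos`), applied to a third of D of one
sign, would then produce such a member. Numerically, with n = |A| and E_+(B) > n^(2+β), one gets |D
+ D| ≲ n^(6-7β)|D|², hence E_×(D) ≲ n^(12-14β)|D|⁴. Balancing 16 - 14β with 2 + β gives β = 14/15;
since 31/33 is larger, a power of n is left to absorb logarithms and constants.

Lower bound. One of B, C contains half of A_N. A dense B has many points on the rows of fixed n,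
which are dilated arithmetic progressions, and this forces additive energy. A dense C has a small
product set, and this forces multiplicative energy. The shape N^(2/3) by N^(1/3) makes the two
bounds equal up to constants. -/

/-- A bound for `∑ f²` from weak-type bounds for the superlevel sets of `f`. -/
lemma sum_sq_le_of_card_superlevel {ι : Type*} (s : Finset ι) (f : ι → ℕ) (N : ℕ) (M : ℝ)
    (hM0 : 0 ≤ M) (hf : ∀ i ∈ s, f i ≤ N)
    (hM : ∀ t : ℕ, 1 ≤ t → t ≤ N → (t : ℝ) ^ 2 * #{i ∈ s | t ≤ f i} ≤ M) :
    ∑ i ∈ s, (f i : ℝ) ^ 2 ≤ 2 * M * (1 + Real.log N) := by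
  -- Discrete layer-cake: f² is replaced by a sum of 2t over t ≤ f. The weak-type bound turns each
  -- level into 2M/t, and the harmonic sum gives the logarithm.
  have key : ∀ n : ℕ, (n : ℝ) ^ 2 ≤ ∑ t ∈ Icc 1 n, 2 * (t : ℝ) := by
    intro n
    induction n with
    | zero => simp
    | succ n ih =>
      rw [sum_Icc_succ_top (by omega)]
      push_cast
      nlinarith
  calc ∑ i ∈ s, (f i : ℝ) ^ 2
      ≤ ∑ i ∈ s, ∑ t ∈ Icc 1 N, if t ≤ f i then 2 * (t : ℝ) else 0 := by
        refine sum_le_sum fun i hi => (key (f i)).trans ?_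
        rw [← sum_filter]
        refine sum_le_sum_of_subset_of_nonneg ?_ fun _ _ _ => by positivity
        intro t ht
        have := hf i hi
        simp only [mem_Icc, mem_filter] at ht ⊢
        omega
    _ = ∑ t ∈ Icc 1 N, 2 * (t : ℝ) * #{i ∈ s | t ≤ f i} := by
        rw [sum_comm]
        refine sum_congr rfl fun t _ => ?_
        rw [← sum_filter, sum_const, nsmul_eq_mul, mul_comm]
    _ ≤ ∑ t ∈ Icc 1 N, 2 * M * (t : ℝ)⁻¹ := by
        refine sum_le_sum fun t ht => ?_
        rw [mem_Icc] at ht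
        have h0 : (0 : ℝ) < t := by exact_mod_cast ht.1
        rw [← div_eq_mul_inv, le_div_iff₀ h0]
        nlinarith [hM t ht.1 ht.2]
    _ ≤ 2 * M * (1 + Real.log N) := by
        rw [← mul_sum]
        refine mul_le_mul_of_nonneg_left ?_ (by positivity)
        have := harmonic_le_one_add_log N
        rw [harmonic_eq_sum_Icc] at this
        push_cast at this
        exact this

/-! ### Solymosi's bound for the multiplicative energy -/

/-- The number of pairs of elements of `s` with quotient `x`. -/
noncomputable def quotCount (s : Finset ℝ) (x : ℝ) : ℕ := #{p ∈ s ×ˢ s | p.2 / p.1 = x}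

lemma quotCount_le_card (s : Finset ℝ) (h0 : (0 : ℝ) ∉ s) (x : ℝ) : quotCount s x ≤ #s := by
  refine card_le_card_of_injOn Prod.fst (fun p hp => ?_) ?_
  · exact (mem_product.1 (mem_filter.1 (mem_coe.1 hp)).1).1
  · rintro ⟨a, b⟩ hp ⟨c, d⟩ hq (h : a = c)
    subst h
    simp only [coe_filter, mem_product, Set.mem_ofPred_eq] at hp hq
    have ha : a ≠ 0 := fun h => h0 (h ▸ hp.1.1)
    have := hp.2.trans hq.2.symm
    rw [div_left_inj' ha] at this
    simp [this]

/-- Rewrites ab = cd as b/a = c/d. The index set U may be larger than s / s, so that several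
energies can be summed over a common set. -/
lemma mulEnergy_eq_sum_quotCount (s t U : Finset ℝ) (hs : (0 : ℝ) ∉ s) (ht : (0 : ℝ) ∉ t)
    (hU : s / s ⊆ U) :
    mulEnergy s t = ∑ x ∈ U, quotCount s x * quotCount t x := by
  unfold mulEnergy
  rw [card_eq_sum_card_fiberwise (f := fun z => z.1.2 / z.1.1) (t := U)]
  · refine sum_congr rfl fun x _ => ?_
    unfold quotCount
    rw [← card_product]
    refine card_nbij' (fun z => (z.1, z.2.swap)) (fun z => (z.1, z.2.swap)) ?_ ?_ ?_ ?_
    · rintro ⟨⟨a, b⟩, c, d⟩ h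
      simp only [coe_filter, mem_filter, mem_product, Set.mem_ofPred_eq, coe_product,
        Set.mem_prod, Prod.swap] at h ⊢
      obtain ⟨⟨⟨⟨ha, hb⟩, hc, hd⟩, h1⟩, h2⟩ := h
      have ha0 : a ≠ 0 := fun h => hs (h ▸ ha)
      have hd0 : d ≠ 0 := fun h => ht (h ▸ hd)
      refine ⟨⟨⟨ha, hb⟩, h2⟩, ⟨hd, hc⟩, ?_⟩
      rw [← h2, div_eq_div_iff hd0 ha0]
      linarith
    · rintro ⟨⟨a, b⟩, c, d⟩ h
      simp only [coe_filter, mem_filter, mem_product, Set.mem_ofPred_eq, coe_product,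
        Set.mem_prod, Prod.swap] at h ⊢
      obtain ⟨⟨⟨ha, hb⟩, h2⟩, ⟨hc, hd⟩, h1⟩ := h
      have ha0 : a ≠ 0 := fun h => hs (h ▸ ha)
      have hd0 : c ≠ 0 := fun h => ht (h ▸ hc)
      refine ⟨⟨⟨⟨ha, hb⟩, hd, hc⟩, ?_⟩, h2⟩
      rw [← h2, div_eq_div_iff hd0 ha0] at h1
      linarith
    · intro z _; simp
    · intro z _; simp
  · rintro ⟨⟨a, b⟩, c, d⟩ h
    simp only [coe_filter, mem_product, Set.mem_ofPred_eq] at h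
    exact hU (div_mem_div h.1.1.2 h.1.1.1)

/-- Here `quotCount A x` counts the points of A × A on the line of slope x through the origin.
Vector sums from two such lines lie strictly between them, and are distinct because the two
directions are linearly independent. -/
lemma card_sum_of_lines (A : Finset ℝ) (hA : ∀ a ∈ A, 0 < a) {x y : ℝ} (hxy : x < y) :
    quotCount A x * quotCount A y ≤
      #{p ∈ (A + A) ×ˢ (A + A) | x * p.1 < p.2 ∧ p.2 < y * p.1} := by
  unfold quotCount
  rw [← card_product]
  refine card_le_card_of_injOn (fun z => z.1 + z.2) ?_ ?_
  · rintro ⟨⟨a, b⟩, c, d⟩ h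
    simp only [mem_product, coe_product, coe_filter, Set.mem_prod,
      Set.mem_ofPred_eq] at h
    obtain ⟨⟨⟨ha, hb⟩, h1⟩, ⟨hc, hd⟩, h2⟩ := h
    have ha0 := hA a ha
    have hc0 := hA c hc
    rw [div_eq_iff ha0.ne'] at h1
    rw [div_eq_iff hc0.ne'] at h2
    simp only [mem_product, coe_filter, Set.mem_ofPred_eq, Prod.mk_add_mk]
    refine ⟨⟨add_mem_add ha hc, add_mem_add hb hd⟩, ?_, ?_⟩
    · subst h1 h2; nlinarith
    · subst h1 h2; nlinarith
  · rintro ⟨⟨a, b⟩, c, d⟩ h ⟨⟨a', b'⟩, c', d'⟩ h' heq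
    simp only [mem_product, coe_product, coe_filter, Set.mem_prod,
      Set.mem_ofPred_eq] at h h'
    obtain ⟨⟨⟨ha, hb⟩, h1⟩, ⟨hc, hd⟩, h2⟩ := h
    obtain ⟨⟨⟨ha', hb'⟩, h1'⟩, ⟨hc', hd'⟩, h2'⟩ := h'
    rw [div_eq_iff (hA _ ha).ne'] at h1
    rw [div_eq_iff (hA _ hc).ne'] at h2
    rw [div_eq_iff (hA _ ha').ne'] at h1'
    rw [div_eq_iff (hA _ hc').ne'] at h2'
    simp only [Prod.mk_add_mk, Prod.mk.injEq] at heq ⊢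
    obtain ⟨e1, e2⟩ := heq
    subst h1 h2 h1' h2'
    have hc : c = c' := by
      have : (y - x) * (c - c') = 0 := by linear_combination e2 - x * e1
      rcases mul_eq_zero.1 this with h | h <;> linarith
    subst hc
    have ha : a = a' := by linarith
    subst ha
    simp

/-- Consecutive rich lines bound pairwise disjoint sectors, each containing at least t² points of (A
+ A)². The line y serves as upper edge of the last sector. -/
lemma card_lines_below (A : Finset ℝ) (hA : ∀ a ∈ A, 0 < a) (t : ℕ) (L : Finset ℝ)
    (hL : ∀ x ∈ L, t ≤ quotCount A x) :
    ∀ y : ℝ, t ≤ quotCount A y → (∀ x ∈ L, x < y) →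
      #L * t ^ 2 ≤ #{p ∈ (A + A) ×ˢ (A + A) | p.2 < y * p.1} := by
  induction L using Finset.induction_on_max with
  | empty => simp
  | insert x L hx ih =>
    intro y hy hxy
    have hxy' : x < y := hxy x (mem_insert_self _ _)
    have h1 := ih (fun z hz => hL z (mem_insert_of_mem hz)) x (hL x (mem_insert_self _ _)) hx
    have h2 := card_sum_of_lines A hA hxy'
    have h3 : t ^ 2 ≤ quotCount A x * quotCount A y := by
      rw [sq]; exact Nat.mul_le_mul (hL x (mem_insert_self _ _)) hy
    have h4 : Disjoint {p ∈ (A + A) ×ˢ (A + A) | p.2 < x * p.1}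
        {p ∈ (A + A) ×ˢ (A + A) | x * p.1 < p.2 ∧ p.2 < y * p.1} := by
      refine disjoint_filter.2 fun p _ h h' => ?_
      exact lt_asymm h h'.1
    have h5 := card_union_of_disjoint h4
    have h6 : ({p ∈ (A + A) ×ˢ (A + A) | p.2 < x * p.1} ∪
        {p ∈ (A + A) ×ˢ (A + A) | x * p.1 < p.2 ∧ p.2 < y * p.1}) ⊆
        {p ∈ (A + A) ×ˢ (A + A) | p.2 < y * p.1} := by
      rw [← filter_or]
      intro p hp
      rw [mem_filter] at hp ⊢
      refine ⟨hp.1, ?_⟩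
      rcases hp.2 with h | h
      · obtain ⟨a, ha, b, hb, hab⟩ := mem_add.1 (mem_product.1 hp.1).1
        have : 0 < p.1 := hab ▸ add_pos (hA a ha) (hA b hb)
        exact h.trans (by gcongr)
      · exact h.2
    have h7 := card_le_card h6
    rw [card_insert_of_notMem (fun h => lt_irrefl _ (hx x h)), add_mul, one_mul]
    omega

lemma sq_mul_card_rich_lines_le (A : Finset ℝ) (hA : ∀ a ∈ A, 0 < a) (t : ℕ) :
    t ^ 2 * #{x ∈ A / A | t ≤ quotCount A x} ≤ 2 * #(A + A) ^ 2 := by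
  set L := {x ∈ A / A | t ≤ quotCount A x} with hLdef
  rcases L.eq_empty_or_nonempty with h | h
  · simp [h]
  have hL : ∀ x ∈ L, t ≤ quotCount A x := fun x hx => (mem_filter.1 hx).2
  have hm := L.max'_mem h
  -- The steepest line has no sector above it; its t² is paid for by t ≤ |A + A|, whence the factor
  -- 2.
  have hlow := card_lines_below A hA t (L.erase (L.max' h))
    (fun x hx => hL x (mem_of_mem_erase hx)) (L.max' h) (hL _ hm)
    (fun x hx => L.lt_max'_of_mem_erase_max' h hx)
  have h1 : #{p ∈ (A + A) ×ˢ (A + A) | p.2 < L.max' h * p.1} ≤ #(A + A) ^ 2 := by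
    rw [sq, ← card_product]; exact card_filter_le _ _
  have h0 : (0 : ℝ) ∉ A := fun h => lt_irrefl _ (hA 0 h)
  have hA0 : A.Nonempty := by
    obtain ⟨a, ha, _⟩ := mem_div.1 (mem_filter.1 hm).1
    exact ⟨a, ha⟩
  have h2 : t ≤ #(A + A) :=
    ((hL _ hm).trans (quotCount_le_card A h0 _)).trans (card_le_card_add_left hA0)
  have h3 := Nat.pow_le_pow_left h2 2
  have h4 := card_erase_add_one hm
  rw [← h4]
  nlinarith

/-- Solymosi's bound for the multiplicative energy of a set of positive reals. -/
lemma mulEnergy_le_of_pos (A : Finset ℝ) (hA : ∀ a ∈ A, 0 < a) :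
    (mulEnergy A A : ℝ) ≤ 4 * (#(A + A) : ℝ) ^ 2 * (1 + Real.log #A) := by
  have h0 : (0 : ℝ) ∉ A := fun h => lt_irrefl _ (hA 0 h)
  have h := sum_sq_le_of_card_superlevel (A / A) (quotCount A) #A (2 * (#(A + A) : ℝ) ^ 2)
    (by positivity)
    (fun x _ => quotCount_le_card A h0 x)
    (fun t _ _ => by exact_mod_cast sq_mul_card_rich_lines_le A hA t)
  rw [mulEnergy_eq_sum_quotCount A A (A / A) h0 h0 Subset.rfl]
  push_cast
  simp_rw [← sq]
  linarith

/-! ### Paths of length three and Balog–Szemerédi–Gowers -/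

lemma sum_le_sum_large_add {ι : Type*} (s : Finset ι) (f : ι → ℝ) {c n : ℝ} (hc : 0 ≤ c)
    (hn : (#s : ℝ) ≤ n) : ∑ i ∈ s, f i ≤ ∑ i ∈ s with c ≤ f i, f i + n * c := by
  rw [← sum_filter_add_sum_filter_not s (fun i => c ≤ f i)]
  gcongr
  calc ∑ i ∈ s with ¬ c ≤ f i, f i ≤ ∑ i ∈ s with ¬ c ≤ f i, c :=
        sum_le_sum fun i hi => (not_le.1 (mem_filter.1 hi).2).le
    _ = (#{i ∈ s | ¬ c ≤ f i} : ℝ) * c := by simp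
    _ ≤ n * c := by
        gcongr
        exact le_trans (by exact_mod_cast card_filter_le _ _) hn

lemma sum_card_filter_comm {α β : Type*} (s : Finset α) (t : Finset β) (r : α → β → Prop)
    [∀ a b, Decidable (r a b)] :
    ∑ x ∈ s, (#{y ∈ t | r x y} : ℝ) = ∑ y ∈ t, (#{x ∈ s | r x y} : ℝ) := by
  simp_rw [card_filter]
  push_cast
  exact sum_comm

set_option maxHeartbeats 2000000 in
/-- A dense bipartite graph contains two large sets of vertices such that any two vertices of
the two sets are joined by many paths of length three. -/
lemma exists_many_paths {α β : Type*} (X : Finset α) (Y : Finset β)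
    (r : α → β → Prop) [∀ a b, Decidable (r a b)] {n g : ℝ} (hX : (#X : ℝ) ≤ n)
    (hY : (#Y : ℝ) ≤ n) (hn : 0 < n) (hg : 0 < g)
    (hE : g ≤ ∑ x ∈ X, (#{y ∈ Y | r x y} : ℝ)) :
    ∃ X' ⊆ X, ∃ Y' ⊆ Y, g / (6 * n) ≤ #X' ∧ g / (4 * n) ≤ #Y' ∧
      ∀ x ∈ X', ∀ y ∈ Y', g ^ 5 / (3072 * n ^ 8) ≤
        #{p ∈ Y ×ˢ X | r x p.1 ∧ r p.2 p.1 ∧ r p.2 y} := by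
  classical
  set X₁ := {x ∈ X | g / (2 * n) ≤ (#{y ∈ Y | r x y} : ℝ)} with hX₁
  have hX₁X : X₁ ⊆ X := filter_subset _ _
  have hX₁n : (#X₁ : ℝ) ≤ n := le_trans (by exact_mod_cast card_le_card hX₁X) hX
  have hdeg : ∀ x ∈ X₁, g / (2 * n) ≤ (#{y ∈ Y | r x y} : ℝ) := fun x hx => (mem_filter.1 hx).2
  set N : β → Finset α := fun y => {x ∈ X₁ | r x y} with hN
  have hsumN : g / 2 ≤ ∑ y ∈ Y, (#(N y) : ℝ) := by
    rw [← sum_card_filter_comm]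
    have := sum_le_sum_large_add X (fun x => (#{y ∈ Y | r x y} : ℝ)) (c := g / (2 * n))
      (by positivity) hX
    have h2 : n * (g / (2 * n)) = g / 2 := by field_simp
    rw [h2] at this
    linarith
  have hsumN2 : g ^ 2 / (4 * n) ≤ ∑ y ∈ Y, (#(N y) : ℝ) ^ 2 := by
    have h1 : (∑ y ∈ Y, (#(N y) : ℝ)) ^ 2 ≤ #Y * ∑ y ∈ Y, (#(N y) : ℝ) ^ 2 :=
      sq_sum_le_card_mul_sum_sq
    have h2 : (#Y : ℝ) * ∑ y ∈ Y, (#(N y) : ℝ) ^ 2 ≤ n * ∑ y ∈ Y, (#(N y) : ℝ) ^ 2 :=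
      mul_le_mul_of_nonneg_right hY (sum_nonneg fun _ _ => sq_nonneg _)
    have h3 : (g / 2) ^ 2 ≤ (∑ y ∈ Y, (#(N y) : ℝ)) ^ 2 :=
      pow_le_pow_left₀ (by positivity) hsumN 2
    rw [div_le_iff₀ (by positivity)]
    nlinarith
  -- Chosen so that the weighted count of bad pairs below is at most g²/(8n), half of the lower
  -- bound in `hsumN2`.
  set h : ℝ := g ^ 3 / (128 * n ^ 5) with hh
  have hh0 : 0 < h := by positivity
  set cod : α × α → ℕ := fun q => #{y ∈ Y | r q.1 y ∧ r q.2 y} with hcod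
  set bad : Finset α → Finset (α × α) := fun U => {q ∈ U ×ˢ U | (cod q : ℝ) < h} with hbad
  have hsumbad : ∑ y ∈ Y, (#(bad (N y)) : ℝ) ≤ n ^ 2 * h := by
    have e : ∀ y ∈ Y, (#(bad (N y)) : ℝ) = #{q ∈ bad X₁ | r q.1 y ∧ r q.2 y} := by
      intro y _
      congr 2
      ext q
      simp only [hbad, hN, mem_filter, mem_product]
      tauto
    rw [sum_congr rfl e, ← sum_card_filter_comm]
    calc ∑ q ∈ bad X₁, (#{y ∈ Y | r q.1 y ∧ r q.2 y} : ℝ) ≤ ∑ q ∈ bad X₁, h :=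
          sum_le_sum fun q hq => (mem_filter.1 hq).2.le
      _ = (#(bad X₁) : ℝ) * h := by simp
      _ ≤ n ^ 2 * h := by
          gcongr
          calc (#(bad X₁) : ℝ) ≤ #(X₁ ×ˢ X₁) := by exact_mod_cast card_filter_le _ _
            _ = (#X₁ : ℝ) ^ 2 := by rw [card_product]; push_cast; ring
            _ ≤ n ^ 2 := by gcongr
  -- Dependent choice by averaging over y: some neighbourhood is large and has few pairs with few
  -- common neighbours.
  obtain ⟨y₀, hy₀, hU⟩ : ∃ y ∈ Y,
      g ^ 2 / (8 * n ^ 2) ≤ (#(N y) : ℝ) ^ 2 - 16 * n ^ 2 / g * #(bad (N y)) := by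
    by_contra! hcon
    have hYne : Y.Nonempty := by
      rw [nonempty_iff_ne_empty]
      rintro rfl
      simp at hE
      linarith
    have h1 := sum_lt_sum_of_nonempty hYne hcon
    rw [sum_sub_distrib, ← mul_sum, sum_const, nsmul_eq_mul] at h1
    have h2 : (#Y : ℝ) * (g ^ 2 / (8 * n ^ 2)) ≤ n * (g ^ 2 / (8 * n ^ 2)) := by gcongr
    have h3 : n * (g ^ 2 / (8 * n ^ 2)) = g ^ 2 / (8 * n) := by field_simp
    have h4 : 16 * n ^ 2 / g * ∑ y ∈ Y, (#(bad (N y)) : ℝ) ≤ 16 * n ^ 2 / g * (n ^ 2 * h) := by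
      gcongr
    have h5 : 16 * n ^ 2 / g * (n ^ 2 * h) = g ^ 2 / (8 * n) := by
      rw [hh]; field_simp; norm_num
    have h6 : g ^ 2 / (4 * n) = g ^ 2 / (8 * n) + g ^ 2 / (8 * n) := by field_simp; norm_num
    linarith
  set U := N y₀ with hUdef
  set u : ℝ := (#U : ℝ) with hu
  have hUX₁ : U ⊆ X₁ := filter_subset _ _
  have hbad0 : 0 ≤ 16 * n ^ 2 / g * (#(bad U) : ℝ) := by positivity
  have hu0 : g / (3 * n) ≤ u := by
    refine le_of_sq_le_sq ?_ (by positivity)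
    have : (g / (3 * n)) ^ 2 ≤ g ^ 2 / (8 * n ^ 2) := by
      rw [div_pow]
      gcongr
      nlinarith [sq_nonneg n]
    linarith
  have hupos : 0 < u := lt_of_lt_of_le (by positivity) hu0
  have hbadU : (#(bad U) : ℝ) ≤ u ^ 2 * g / (16 * n ^ 2) := by
    have : 0 ≤ g ^ 2 / (8 * n ^ 2) := by positivity
    have h1 : 16 * n ^ 2 / g * (#(bad U) : ℝ) ≤ u ^ 2 := by linarith
    rw [le_div_iff₀ (by positivity)]
    rw [div_mul_eq_mul_div, div_le_iff₀ hg] at h1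
    linarith
  set badd : α → ℕ := fun x => #{x' ∈ U | (cod (x, x') : ℝ) < h} with hbadd
  have hbsum : ∑ x ∈ U, (badd x : ℝ) = #(bad U) := by
    rw [hbad, hbadd]
    simp only [card_filter, sum_product]
    push_cast
    rfl
  set X' := {x ∈ U | ¬ u * g / (8 * n ^ 2) ≤ (badd x : ℝ)} with hX'
  have hX'card : u / 2 ≤ (#X' : ℝ) := by
    have h1 : (#{x ∈ U | u * g / (8 * n ^ 2) ≤ (badd x : ℝ)} : ℝ) * (u * g / (8 * n ^ 2))
        ≤ #(bad U) := by
      rw [← hbsum, ← nsmul_eq_mul]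
      refine (card_nsmul_le_sum _ (fun x => (badd x : ℝ)) _ fun x hx => (mem_filter.1 hx).2).trans ?_
      exact sum_le_sum_of_subset_of_nonneg (filter_subset _ _) fun _ _ _ => by positivity
    have h2 := card_filter_add_card_filter_not (s := U) (fun x => u * g / (8 * n ^ 2) ≤ (badd x : ℝ))
    have h2' : (#{x ∈ U | u * g / (8 * n ^ 2) ≤ (badd x : ℝ)} : ℝ) + #X' = u := by
      have h3 := congrArg (Nat.cast (R := ℝ)) h2
      rw [Nat.cast_add] at h3
      exact h3
    have h3 : u ^ 2 * g / (16 * n ^ 2) = u / 2 * (u * g / (8 * n ^ 2)) := by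
      field_simp; norm_num
    have h4 : 0 < u * g / (8 * n ^ 2) := by positivity
    have h5 : (#{x ∈ U | u * g / (8 * n ^ 2) ≤ (badd x : ℝ)} : ℝ) ≤ u / 2 :=
      le_of_mul_le_mul_right (by linarith) h4
    linarith
  set Y' := {y ∈ Y | u * g / (4 * n ^ 2) ≤ (#{x ∈ U | r x y} : ℝ)} with hY'
  have hY'card : g / (4 * n) ≤ (#Y' : ℝ) := by
    have h1 := sum_le_sum_large_add Y (fun y => (#{x ∈ U | r x y} : ℝ))
      (c := u * g / (4 * n ^ 2)) (by positivity) hY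
    rw [← sum_card_filter_comm] at h1
    have h2 : u * (g / (2 * n)) ≤ ∑ x ∈ U, (#{y ∈ Y | r x y} : ℝ) := by
      rw [hu, ← nsmul_eq_mul]
      exact card_nsmul_le_sum _ _ _ fun x hx => hdeg x (hUX₁ hx)
    have h3 : ∑ y ∈ Y', (#{x ∈ U | r x y} : ℝ) ≤ #Y' * u := by
      rw [← nsmul_eq_mul]
      exact sum_le_card_nsmul _ _ _ fun y _ => by rw [hu]; exact_mod_cast card_filter_le _ _
    have h4 : n * (u * g / (4 * n ^ 2)) = u * (g / (4 * n)) := by field_simp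
    have h5 : u * (g / (2 * n)) = u * (g / (4 * n)) + u * (g / (4 * n)) := by field_simp; norm_num
    have h6 : u * (g / (4 * n)) ≤ u * #Y' := by linarith
    exact le_of_mul_le_mul_left h6 hupos
  refine ⟨X', (filter_subset _ _).trans (hUX₁.trans hX₁X), Y', filter_subset _ _, ?_, hY'card, ?_⟩
  · have : g / (6 * n) = g / (3 * n) / 2 := by field_simp; norm_num
    linarith
  intro x hx y hy
  have hx2 : (badd x : ℝ) < u * g / (8 * n ^ 2) := not_le.1 (mem_filter.1 hx).2
  have hy2 := (mem_filter.1 hy).2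
  -- The third vertices of the paths x – y' – x' – y. The degree of y into U is at least twice the
  -- bound on the bad partners of x, so at least half of that bound on the degree survives.
  set V := {x' ∈ U | r x' y ∧ ¬ (cod (x, x') : ℝ) < h} with hV
  have hVcard : u * g / (8 * n ^ 2) ≤ (#V : ℝ) := by
    have h1 : {x' ∈ U | r x' y} ⊆ V ∪ {x' ∈ U | (cod (x, x') : ℝ) < h} := by
      intro z hz
      simp only [hV, mem_union, mem_filter] at hz ⊢
      tauto
    have h2 : (#{x' ∈ U | r x' y} : ℝ) ≤ #V + badd x := by
      exact_mod_cast (card_le_card h1).trans (card_union_le _ _)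
    have h3 : u * g / (4 * n ^ 2) = u * g / (8 * n ^ 2) + u * g / (8 * n ^ 2) := by
      field_simp; norm_num
    linarith
  have hpaths : ∑ x' ∈ V, cod (x, x') ≤ #{p ∈ Y ×ˢ X | r x p.1 ∧ r p.2 p.1 ∧ r p.2 y} := by
    rw [hcod, ← card_sigma]
    refine card_le_card_of_injOn (fun z => (z.2, z.1)) ?_ ?_
    · rintro ⟨x', y'⟩ hz
      simp only [coe_sigma, Set.mem_sigma_iff, mem_coe, hV, mem_filter, mem_product] at hz ⊢
      exact ⟨⟨hz.2.1, hX₁X (hUX₁ hz.1.1)⟩, hz.2.2.1, hz.2.2.2, hz.1.2.1⟩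
    · rintro ⟨x', y'⟩ _ ⟨x'', y''⟩ _ heq
      simp only [Prod.mk.injEq] at heq
      obtain ⟨rfl, rfl⟩ := heq
      rfl
  calc g ^ 5 / (3072 * n ^ 8) = (g / (3 * n)) * g / (8 * n ^ 2) * h := by
        rw [hh]; field_simp; norm_num
    _ ≤ u * g / (8 * n ^ 2) * h := by gcongr
    _ ≤ #V * h := by gcongr
    _ ≤ ∑ x' ∈ V, (cod (x, x') : ℝ) := by
        rw [← nsmul_eq_mul]
        exact card_nsmul_le_sum _ _ _ fun z hz => not_lt.1 (mem_filter.1 hz).2.2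
    _ ≤ _ := by exact_mod_cast hpaths

section AddCommGroup
variable {G : Type*} [AddCommGroup G] [DecidableEq G]

/-- A path from a to b writes a + b = (a + y) - (x + y) + (x + b) with all three terms in S, and
distinct paths give distinct triples. -/
lemma card_add_mul_le_of_paths (A B C S : Finset G) (P : ℝ)
    (h : ∀ a ∈ A, ∀ b ∈ B,
      P ≤ #{p ∈ C ×ˢ C | a + p.1 ∈ S ∧ p.2 + p.1 ∈ S ∧ p.2 + b ∈ S}) :
    #(A + B) * P ≤ (#S : ℝ) ^ 3 := by
  have h1 : ∑ z ∈ A + B, (#{s ∈ S ×ˢ S ×ˢ S | s.1 - s.2.1 + s.2.2 = z} : ℝ) ≤ (#S : ℝ) ^ 3 := by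
    have : ∑ z ∈ A + B, #{s ∈ S ×ˢ S ×ˢ S | s.1 - s.2.1 + s.2.2 = z} ≤ #S ^ 3 := by
      rw [sum_card_fiberwise_eq_card_filter]
      refine (card_filter_le _ _).trans_eq ?_
      rw [card_product, card_product]; ring
    exact_mod_cast this
  refine le_trans ?_ h1
  rw [← nsmul_eq_mul]
  refine card_nsmul_le_sum _ _ _ fun z hz => ?_
  obtain ⟨a, ha, b, hb, rfl⟩ := mem_add.1 hz
  refine (h a ha b hb).trans ?_
  norm_cast
  refine card_le_card_of_injOn (fun p => (a + p.1, p.2 + p.1, p.2 + b)) ?_ ?_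
  · rintro ⟨y, x⟩ hp
    simp only [coe_filter, mem_product, Set.mem_ofPred_eq] at hp ⊢
    refine ⟨⟨hp.2.1, hp.2.2.1, hp.2.2.2⟩, ?_⟩
    abel
  · rintro ⟨y, x⟩ _ ⟨y', x'⟩ _ heq
    simp only [Prod.mk.injEq, add_right_inj, add_left_inj] at heq ⊢
    exact ⟨heq.1, heq.2.2⟩

/-- A Balog–Szemerédi–Gowers theorem: a set of large additive energy has a large subset with a
small sumset. -/
lemma exists_small_sumset (B : Finset G) {n W : ℝ} (hn : (#B : ℝ) ≤ n) (hW : 0 < W)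
    (h : 2 * W * (1 + Real.log #B) < addEnergy B B) :
    ∃ D ⊆ B, D.Nonempty ∧
      (#(D + D) : ℝ) ≤ 3072 ^ 2 * 144 * n ^ 20 / W ^ 7 * (#D : ℝ) ^ 2 := by
  set f : G → ℕ := fun z => #{xy ∈ B ×ˢ B | xy.1 + xy.2 = z} with hf
  have hfB : ∀ z ∈ B + B, f z ≤ #B := by
    intro z _
    refine card_le_card_of_injOn Prod.fst (fun p hp => ?_) ?_
    · exact (mem_product.1 (mem_filter.1 (mem_coe.1 hp)).1).1
    · rintro ⟨a, b⟩ hp ⟨c, d⟩ hq (h : a = c)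
      subst h
      simp only [coe_filter, mem_product, Set.mem_ofPred_eq] at hp hq
      have := hp.2.trans hq.2.symm
      rw [add_right_inj] at this
      rw [this]
  obtain ⟨t, ht1, htB, ht⟩ : ∃ t : ℕ, 1 ≤ t ∧ t ≤ #B ∧
      W < (t : ℝ) ^ 2 * #{z ∈ B + B | t ≤ f z} := by
    by_contra! hcon
    have := sum_sq_le_of_card_superlevel (B + B) f #B W hW.le hfB hcon
    rw [addEnergy_eq_sum_sq'] at h
    push_cast at h
    linarith
  set S := {z ∈ B + B | t ≤ f z} with hS
  have ht0 : (0 : ℝ) < t := by exact_mod_cast ht1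
  have htn : (t : ℝ) ≤ n := le_trans (by exact_mod_cast htB) hn
  have hn0 : 0 < n := ht0.trans_le htn
  set N : ℝ := (#S : ℝ) with hN
  have hN0 : 0 < N := by
    by_contra hN0
    have : N = 0 := le_antisymm (not_lt.1 hN0) (by positivity)
    rw [this, mul_zero] at ht
    linarith
  have hg : 0 < N * t := by positivity
  have hE : N * t ≤ ∑ x ∈ B, (#{y ∈ B | x + y ∈ S} : ℝ) := by
    have h1 : ∑ z ∈ S, f z = ∑ x ∈ B, #{y ∈ B | x + y ∈ S} := by
      rw [hf, sum_card_fiberwise_eq_card_filter]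
      simp only [card_filter, sum_product]
    have h2 : #S * t ≤ ∑ z ∈ S, f z := by
      rw [← smul_eq_mul]
      exact card_nsmul_le_sum _ _ _ fun z hz => (mem_filter.1 hz).2
    rw [h1] at h2
    rw [hN]
    exact_mod_cast h2
  obtain ⟨A', hA', B', hB', ha, hb, hP⟩ :=
    exists_many_paths B B (fun x y => x + y ∈ S) hn hn hn0 hg hE
  refine ⟨A', hA', ?_, ?_⟩
  · rw [← card_pos]
    have : (0 : ℝ) < #A' := lt_of_lt_of_le (by positivity) ha
    exact_mod_cast this
  have hq := card_add_mul_le_of_paths A' B' B S _ hP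
  have hruzsa : (#(A' + A') : ℝ) * #B' ≤ (#(A' + B') : ℝ) ^ 2 := by
    have := ruzsa_triangle_inequality_add_add_add A' B' A'
    rw [add_comm B' A', ← sq] at this
    exact_mod_cast this
  set q : ℝ := (#(A' + B') : ℝ)
  set a : ℝ := (#A' : ℝ)
  set b : ℝ := (#B' : ℝ)
  set σ : ℝ := (#(A' + A') : ℝ)
  set g : ℝ := N * t with hgdef
  have hq' : q ≤ N ^ 3 * (3072 * n ^ 8) / g ^ 5 := by
    rw [le_div_iff₀ (by positivity)]
    rw [mul_div_assoc', div_le_iff₀ (by positivity)] at hq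
    exact hq
  have hb0 : 0 < b := lt_of_lt_of_le (by positivity) hb
  -- One of the fourteen factors t is traded for n, so that N⁶ · N⁷ t¹³ is exactly g¹³ in the
  -- computation below.
  have hWN : W ^ 7 ≤ N ^ 7 * t ^ 13 * n := by
    calc W ^ 7 ≤ ((t : ℝ) ^ 2 * N) ^ 7 := by gcongr
      _ = N ^ 7 * t ^ 13 * t := by ring
      _ ≤ _ := by gcongr
  have hσ0 : 0 ≤ σ := by positivity
  have hq0 : 0 ≤ q := by positivity
  calc σ ≤ q ^ 2 / b := by rwa [le_div_iff₀ hb0]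
    _ ≤ (N ^ 3 * (3072 * n ^ 8) / g ^ 5) ^ 2 / (g / (4 * n)) := by gcongr
    _ = 3072 ^ 2 * 4 * N ^ 6 * n ^ 17 / g ^ 11 := by field_simp
    _ ≤ 3072 ^ 2 * 4 * n ^ 18 * g ^ 2 / W ^ 7 := by
        rw [div_le_div_iff₀ (by positivity) (by positivity)]
        calc 3072 ^ 2 * 4 * N ^ 6 * n ^ 17 * W ^ 7
            ≤ 3072 ^ 2 * 4 * N ^ 6 * n ^ 17 * (N ^ 7 * t ^ 13 * n) := by gcongr
          _ = _ := by rw [hgdef]; ring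
    _ = 3072 ^ 2 * 144 * n ^ 20 / W ^ 7 * (g / (6 * n)) ^ 2 := by field_simp; norm_num
    _ ≤ _ := by gcongr

end AddCommGroup

/-! ### Subadditivity of the fourth root of multiplicative energy -/

lemma mulEnergy_sq_le (s t : Finset ℝ) (hs : (0 : ℝ) ∉ s) (ht : (0 : ℝ) ∉ t) :
    mulEnergy s t ^ 2 ≤ mulEnergy s s * mulEnergy t t := by
  rw [mulEnergy_eq_sum_quotCount s t (s / s ∪ t / t) hs ht subset_union_left,
    mulEnergy_eq_sum_quotCount s s (s / s ∪ t / t) hs hs subset_union_left,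
    mulEnergy_eq_sum_quotCount t t (s / s ∪ t / t) ht ht subset_union_right]
  simp_rw [← sq]
  exact sum_mul_sq_le_sq_mul_sq _ _ _

/-- Minkowski's inequality for three sequences, squared form. -/
lemma sum_add_sq_le {ι : Type*} (u : Finset ι) (f g h : ι → ℝ) {a b c : ℝ}
    (ha : 0 ≤ a) (hb : 0 ≤ b) (hc : 0 ≤ c) (hf : ∑ i ∈ u, f i ^ 2 ≤ a ^ 2)
    (hg : ∑ i ∈ u, g i ^ 2 ≤ b ^ 2) (hh : ∑ i ∈ u, h i ^ 2 ≤ c ^ 2) :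
    ∑ i ∈ u, (f i + g i + h i) ^ 2 ≤ (a + b + c) ^ 2 := by
  have cs : ∀ (f g : ι → ℝ) {a b : ℝ}, 0 ≤ a → 0 ≤ b → ∑ i ∈ u, f i ^ 2 ≤ a ^ 2 →
      ∑ i ∈ u, g i ^ 2 ≤ b ^ 2 → ∑ i ∈ u, f i * g i ≤ a * b := by
    intro f g a b ha hb hf hg
    refine le_of_sq_le_sq ?_ (by positivity)
    calc (∑ i ∈ u, f i * g i) ^ 2 ≤ (∑ i ∈ u, f i ^ 2) * ∑ i ∈ u, g i ^ 2 :=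
          sum_mul_sq_le_sq_mul_sq _ _ _
      _ ≤ a ^ 2 * b ^ 2 := mul_le_mul hf hg (sum_nonneg fun _ _ => sq_nonneg _) (sq_nonneg _)
      _ = (a * b) ^ 2 := by ring
  have e : ∑ i ∈ u, (f i + g i + h i) ^ 2 = ∑ i ∈ u, f i ^ 2 + ∑ i ∈ u, g i ^ 2 +
      ∑ i ∈ u, h i ^ 2 + 2 * ∑ i ∈ u, f i * g i + 2 * ∑ i ∈ u, f i * h i +
      2 * ∑ i ∈ u, g i * h i := by
    simp only [mul_sum, ← sum_add_distrib]
    exact sum_congr rfl fun i _ => by ring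
  rw [e]
  linarith [cs f g ha hb hf hg, cs f h ha hc hf hh, cs g h hb hc hg hh,
    show (a + b + c) ^ 2 = a ^ 2 + b ^ 2 + c ^ 2 + 2 * (a * b) + 2 * (a * c) + 2 * (b * c) by ring]

lemma sum_sq_le_mulEnergy (s t u : Finset ℝ) :
    ∑ z ∈ u, #{p ∈ s ×ˢ t | p.1 * p.2 = z} ^ 2 ≤ mulEnergy s t := by
  rw [mulEnergy_eq_sum_sq']
  refine sum_le_sum_of_ne_zero fun z _ hz => ?_
  have : #{p ∈ s ×ˢ t | p.1 * p.2 = z} ≠ 0 := fun h => hz (by simp [h])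
  obtain ⟨p, hp⟩ := card_ne_zero.1 this
  simp only [mem_filter, mem_product] at hp
  exact hp.2 ▸ mul_mem_mul hp.1.1 hp.1.2

/-- The fourth root of the multiplicative energy is subadditive. -/
lemma mulEnergy_union_le (s t : Finset ℝ) (hs : (0 : ℝ) ∉ s) (ht : (0 : ℝ) ∉ t) {a b : ℝ}
    (ha : 0 ≤ a) (hb : 0 ≤ b) (hsa : (mulEnergy s s : ℝ) ≤ a ^ 4)
    (htb : (mulEnergy t t : ℝ) ≤ b ^ 4) :
    (mulEnergy (s ∪ t) (s ∪ t) : ℝ) ≤ (a + b) ^ 4 := by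
  have hst : (mulEnergy s t : ℝ) ≤ (a * b) ^ 2 := by
    refine le_of_sq_le_sq ?_ (by positivity)
    calc (mulEnergy s t : ℝ) ^ 2 ≤ mulEnergy s s * mulEnergy t t := by
          exact_mod_cast mulEnergy_sq_le s t hs ht
      _ ≤ a ^ 4 * b ^ 4 := by gcongr
      _ = ((a * b) ^ 2) ^ 2 := by ring
  -- The three representation functions have ℓ² norms at most a², ab and b², so Minkowski yields a²
  -- + 2ab + b² = (a + b)².
  have hcount : ∀ z : ℝ, (#{p ∈ (s ∪ t) ×ˢ (s ∪ t) | p.1 * p.2 = z} : ℝ) ≤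
      #{p ∈ s ×ˢ s | p.1 * p.2 = z} + 2 * #{p ∈ s ×ˢ t | p.1 * p.2 = z} +
      #{p ∈ t ×ˢ t | p.1 * p.2 = z} := by
    intro z
    have h1 : #{p ∈ t ×ˢ s | p.1 * p.2 = z} = #{p ∈ s ×ˢ t | p.1 * p.2 = z} := by
      refine card_nbij' Prod.swap Prod.swap ?_ ?_ (fun _ _ => rfl) (fun _ _ => rfl) <;>
      · rintro ⟨x, y⟩ h
        simp only [coe_filter, mem_product, Set.mem_ofPred_eq, Prod.swap] at h ⊢
        rw [mul_comm y x]
        tauto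
    have h2 : {p ∈ (s ∪ t) ×ˢ (s ∪ t) | p.1 * p.2 = z} ⊆
        ({p ∈ s ×ˢ s | p.1 * p.2 = z} ∪ {p ∈ s ×ˢ t | p.1 * p.2 = z}) ∪
        ({p ∈ t ×ˢ s | p.1 * p.2 = z} ∪ {p ∈ t ×ˢ t | p.1 * p.2 = z}) := by
      intro p
      simp only [mem_filter, mem_union, mem_product]
      tauto
    have h3 := card_le_card h2
    have h4 := card_union_le ({p ∈ s ×ˢ s | p.1 * p.2 = z} ∪ {p ∈ s ×ˢ t | p.1 * p.2 = z})
      ({p ∈ t ×ˢ s | p.1 * p.2 = z} ∪ {p ∈ t ×ˢ t | p.1 * p.2 = z})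
    have h5 := card_union_le {p ∈ s ×ˢ s | p.1 * p.2 = z} {p ∈ s ×ˢ t | p.1 * p.2 = z}
    have h6 := card_union_le {p ∈ t ×ˢ s | p.1 * p.2 = z} {p ∈ t ×ˢ t | p.1 * p.2 = z}
    norm_cast
    omega
  rw [mulEnergy_eq_sum_sq' (s ∪ t)]
  push_cast
  set u := (s ∪ t) * (s ∪ t)
  calc ∑ z ∈ u, (#{p ∈ (s ∪ t) ×ˢ (s ∪ t) | p.1 * p.2 = z} : ℝ) ^ 2
      ≤ ∑ z ∈ u, ((#{p ∈ s ×ˢ s | p.1 * p.2 = z} : ℝ) + 2 * #{p ∈ s ×ˢ t | p.1 * p.2 = z} +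
          #{p ∈ t ×ˢ t | p.1 * p.2 = z}) ^ 2 := by
        gcongr with z
        exact hcount z
    _ ≤ (a ^ 2 + 2 * (a * b) + b ^ 2) ^ 2 := by
        refine sum_add_sq_le u _ _ _ (by positivity) (by positivity) (by positivity) ?_ ?_ ?_
        · calc _ ≤ (mulEnergy s s : ℝ) := by exact_mod_cast sum_sq_le_mulEnergy s s u
            _ ≤ a ^ 4 := hsa
            _ = _ := by ring
        · simp_rw [mul_pow (2 : ℝ) _ 2]
          rw [← mul_sum]
          have : ∑ z ∈ u, (#{p ∈ s ×ˢ t | p.1 * p.2 = z} : ℝ) ^ 2 ≤ mulEnergy s t := by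
            exact_mod_cast sum_sq_le_mulEnergy s t u
          have := this.trans hst
          gcongr
        · calc _ ≤ (mulEnergy t t : ℝ) := by exact_mod_cast sum_sq_le_mulEnergy t t u
            _ ≤ b ^ 4 := htb
            _ = _ := by ring
    _ = (a + b) ^ 4 := by ring

/-- Sets whose multiplicative energy is at most `θ ^ 4` times the fourth power of their
cardinality are closed under disjoint unions. -/
lemma mulEnergy_disjUnion_le (s t : Finset ℝ) (hs : (0 : ℝ) ∉ s) (ht : (0 : ℝ) ∉ t)
    (hst : Disjoint s t) {θ : ℝ} (hθ : 0 ≤ θ) (h1 : (mulEnergy s s : ℝ) ≤ θ ^ 4 * (#s : ℝ) ^ 4)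
    (h2 : (mulEnergy t t : ℝ) ≤ θ ^ 4 * (#t : ℝ) ^ 4) :
    (mulEnergy (s ∪ t) (s ∪ t) : ℝ) ≤ θ ^ 4 * (#(s ∪ t) : ℝ) ^ 4 := by
  rw [← mul_pow] at h1 h2 ⊢
  refine (mulEnergy_union_le s t hs ht (by positivity) (by positivity) h1 h2).trans_eq ?_
  rw [card_union_of_disjoint hst]
  push_cast
  ring

lemma mulEnergy_neg (s : Finset ℝ) : mulEnergy (-s) (-s) = mulEnergy s s := by
  have key : ∀ s : Finset ℝ, mulEnergy s s ≤ mulEnergy (-s) (-s) := by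
    intro s
    unfold mulEnergy
    refine card_le_card_of_injOn (fun z => -z) ?_ neg_injective.injOn
    rintro ⟨⟨a, b⟩, c, d⟩ h
    simpa using h
  refine le_antisymm ?_ (key s)
  simpa using key (-s)

lemma mulEnergy_le_of_neg (A : Finset ℝ) (hA : ∀ a ∈ A, a < 0) :
    (mulEnergy A A : ℝ) ≤ 4 * (#(A + A) : ℝ) ^ 2 * (1 + Real.log #A) := by
  have h := mulEnergy_le_of_pos (-A) (fun a ha => by
    rw [mem_neg] at ha
    obtain ⟨b, hb, rfl⟩ := ha
    have := hA b hb
    linarith)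
  rw [mulEnergy_neg, card_neg, ← neg_add, card_neg] at h
  exact h

/-- A set of at least three reals has a third of its elements of one strict sign. -/
lemma exists_large_signed_subset (D : Finset ℝ) (hD : 3 ≤ #D) :
    ∃ D' ⊆ D, #D ≤ 3 * #D' ∧ ((∀ a ∈ D', 0 < a) ∨ ∀ a ∈ D', a < 0) := by
  have h : D ⊆ ({x ∈ D | 0 < x} ∪ {x ∈ D | x < 0}) ∪ {0} := by
    intro x hx
    simp only [mem_union, mem_filter, mem_singleton]
    rcases lt_trichotomy x 0 with h | h | h <;> tauto
  have h1 := (card_le_card h).trans ((card_union_le _ _).trans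
    (Nat.add_le_add_right (card_union_le _ _) _))
  rw [card_singleton] at h1
  by_cases hc : #{x ∈ D | x < 0} ≤ #{x ∈ D | 0 < x}
  · exact ⟨{x ∈ D | 0 < x}, filter_subset _ _, by omega, Or.inl fun a ha => (mem_filter.1 ha).2⟩
  · exact ⟨{x ∈ D | x < 0}, filter_subset _ _, by omega, Or.inr fun a ha => (mem_filter.1 ha).2⟩

/-! ### The example and the lower bound 1/3 -/

/-- The parametrization of `exampleSet`. -/
noncomputable def oddMulPow (p : ℕ × ℕ) : ℝ := (2 * (p.1 : ℝ) - 1) * 2 ^ p.2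

lemma oddMulPow_injOn : Set.InjOn oddMulPow {p | 1 ≤ p.1} := by
  have key : ∀ m n m' k : ℕ, 1 ≤ m → 1 ≤ m' → oddMulPow (m, n) = oddMulPow (m', n + k) →
      m = m' ∧ k = 0 := by
    intro m n m' k hm hm' h
    simp only [oddMulPow, pow_add] at h
    have h2 : (2 : ℝ) ^ n ≠ 0 := by positivity
    have h3 : 2 * (m : ℝ) - 1 = (2 * m' - 1) * 2 ^ k := by
      apply mul_right_cancel₀ h2
      rw [h]; ring
    cases k with
    | zero =>
      simp only [pow_zero, mul_one, sub_left_inj, mul_eq_mul_left_iff, Nat.cast_inj] at h3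
      simpa using h3
    | succ k =>
      exfalso
      have h4 : ((2 * m + 2 ^ (k + 1) : ℕ) : ℝ) = ((2 * m' * 2 ^ (k + 1) + 1 : ℕ) : ℝ) := by
        push_cast; linear_combination h3
      have h5 : 2 * m + 2 ^ (k + 1) = 2 * m' * 2 ^ (k + 1) + 1 := by exact_mod_cast h4
      rw [pow_succ, mul_assoc] at h5
      omega
  rintro ⟨m, n⟩ (hm : 1 ≤ m) ⟨m', n'⟩ (hm' : 1 ≤ m') h
  rcases le_total n n' with hn | hn
  · obtain ⟨k, rfl⟩ := Nat.exists_eq_add_of_le hn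
    obtain ⟨rfl, rfl⟩ := key m n m' k hm hm' h
    rfl
  · obtain ⟨k, rfl⟩ := Nat.exists_eq_add_of_le hn
    obtain ⟨rfl, rfl⟩ := key m' n' m k hm' hm h.symm
    rfl

lemma card_image_oddMulPow (M T : ℕ) :
    #((Icc 1 M ×ˢ Icc 1 T).image oddMulPow) = M * T := by
  rw [card_image_of_injOn]
  · simp
  · refine oddMulPow_injOn.mono fun p hp => ?_
    simp only [coe_product, coe_Icc, Set.mem_prod, Set.mem_Icc] at hp
    exact hp.1.1

lemma sum_addEnergy_le {ι : Type*} (s : Finset ι) (B : Finset ℝ) (f : ι → Finset ℝ)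
    (hf : ∀ i ∈ s, f i ⊆ B) (hd : (s : Set ι).PairwiseDisjoint f) :
    ∑ i ∈ s, addEnergy (f i) (f i) ≤ addEnergy B B := by
  unfold addEnergy
  rw [← card_biUnion]
  · refine card_le_card fun z hz => ?_
    simp only [mem_biUnion, mem_filter, mem_product] at hz ⊢
    obtain ⟨i, hi, ⟨⟨h1, h2⟩, h3, h4⟩, h5⟩ := hz
    have := hf i hi
    exact ⟨⟨⟨this h1, this h2⟩, this h3, this h4⟩, h5⟩
  · intro i hi j hj hij
    rw [Function.onFun, Finset.disjoint_left]
    intro z hz hz'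
    simp only [mem_filter, mem_product] at hz hz'
    exact Finset.disjoint_left.1 (hd hi hj hij) hz.1.1.1 hz'.1.1.1

lemma sum_pow_four_le {ι : Type*} (s : Finset ι) (f : ι → ℕ) :
    (∑ i ∈ s, f i) ^ 4 ≤ #s ^ 3 * ∑ i ∈ s, f i ^ 4 := by
  have h1 : (∑ i ∈ s, f i) ^ 2 ≤ #s * ∑ i ∈ s, f i ^ 2 := sq_sum_le_card_mul_sum_sq
  have h2 : (∑ i ∈ s, f i ^ 2) ^ 2 ≤ #s * ∑ i ∈ s, (f i ^ 2) ^ 2 := sq_sum_le_card_mul_sum_sq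
  simp_rw [← pow_mul] at h2
  calc (∑ i ∈ s, f i) ^ 4 = ((∑ i ∈ s, f i) ^ 2) ^ 2 := by ring
    _ ≤ (#s * ∑ i ∈ s, f i ^ 2) ^ 2 := Nat.pow_le_pow_left h1 2
    _ = #s ^ 2 * (∑ i ∈ s, f i ^ 2) ^ 2 := by ring
    _ ≤ #s ^ 2 * (#s * ∑ i ∈ s, f i ^ (2 * 2)) := Nat.mul_le_mul_left _ h2
    _ = _ := by ring

/-- On each of the T rows, the sumset has at most 2M elements, so Cauchy–Schwarz bounds the energy
from below. Hölder combines the rows, whose energies add up to at most that of B. -/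
lemma card_pow_four_le_addEnergy (M T : ℕ) (B : Finset ℝ)
    (hB : B ⊆ (Icc 1 M ×ˢ Icc 1 T).image oddMulPow) :
    #B ^ 4 ≤ 2 * T ^ 3 * M * addEnergy B B := by
  set R : ℕ → Finset ℝ := fun n => (Icc 1 M).image fun m => oddMulPow (m, n) with hR
  have hdisj : (↑(Icc 1 T) : Set ℕ).PairwiseDisjoint fun n => B ∩ R n := by
    intro n _ n' _ hnn'
    rw [Function.onFun, Finset.disjoint_left]
    intro z hz hz'
    simp only [hR, mem_inter, mem_image, mem_Icc] at hz hz'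
    obtain ⟨_, m, hm, rfl⟩ := hz
    obtain ⟨_, m', hm', h⟩ := hz'
    have := oddMulPow_injOn (x₁ := (m', n')) hm'.1 (x₂ := (m, n)) hm.1 h
    exact hnn' (Prod.ext_iff.1 this).2.symm
  have hcard : #B ≤ ∑ n ∈ Icc 1 T, #(B ∩ R n) := by
    rw [← card_biUnion hdisj]
    refine card_le_card fun z hz => ?_
    obtain ⟨⟨m, n⟩, hp, rfl⟩ := mem_image.1 (hB hz)
    rw [mem_product] at hp
    simp only [mem_biUnion, mem_inter, hR, mem_image]
    exact ⟨n, hp.2, hz, m, hp.1, rfl⟩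
  have hrow : ∀ n, #(B ∩ R n) ^ 4 ≤ 2 * M * addEnergy (B ∩ R n) (B ∩ R n) := by
    intro n
    have h1 := le_card_add_mul_addEnergy (B ∩ R n) (B ∩ R n)
    have h2 : #(B ∩ R n + B ∩ R n) ≤ 2 * M := by
      have : B ∩ R n + B ∩ R n ⊆
          (Icc 1 (2 * M)).image fun k : ℕ => (2 * (k : ℝ) - 2) * 2 ^ n := by
        intro z hz
        obtain ⟨x, hx, y, hy, rfl⟩ := mem_add.1 hz
        simp only [hR, mem_inter, mem_image, mem_Icc] at hx hy ⊢
        obtain ⟨_, m, hm, rfl⟩ := hx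
        obtain ⟨_, m', hm', rfl⟩ := hy
        refine ⟨m + m', by omega, ?_⟩
        simp only [oddMulPow]
        push_cast
        ring
      simpa using (card_le_card this).trans card_image_le
    calc #(B ∩ R n) ^ 4 = #(B ∩ R n) ^ 2 * #(B ∩ R n) ^ 2 := by ring
      _ ≤ _ := h1
      _ ≤ _ := Nat.mul_le_mul_right _ h2
  calc #B ^ 4 ≤ (∑ n ∈ Icc 1 T, #(B ∩ R n)) ^ 4 := Nat.pow_le_pow_left hcard 4
    _ ≤ #(Icc 1 T) ^ 3 * ∑ n ∈ Icc 1 T, #(B ∩ R n) ^ 4 := sum_pow_four_le _ _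
    _ ≤ T ^ 3 * ∑ n ∈ Icc 1 T, 2 * M * addEnergy (B ∩ R n) (B ∩ R n) := by
        rw [Nat.card_Icc, Nat.add_sub_cancel]
        exact Nat.mul_le_mul_left _ (sum_le_sum fun n _ => hrow n)
    _ = T ^ 3 * (2 * M * ∑ n ∈ Icc 1 T, addEnergy (B ∩ R n) (B ∩ R n)) := by
        rw [← mul_sum]
    _ ≤ T ^ 3 * (2 * M * addEnergy B B) := by
        gcongr
        exact sum_addEnergy_le _ _ _ (fun _ _ => inter_subset_left) hdisj
    _ = _ := by ring

/-- A product is determined by the two odd parts and the sum of the exponents, so C * C has at most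
2M²T elements; Cauchy–Schwarz does the rest. -/
lemma card_pow_four_le_mulEnergy (M T : ℕ) (C : Finset ℝ)
    (hC : C ⊆ (Icc 1 M ×ˢ Icc 1 T).image oddMulPow) :
    #C ^ 4 ≤ 2 * M ^ 2 * T * mulEnergy C C := by
  have h1 := le_card_mul_mul_mulEnergy C C
  have h2 : C * C ⊆ ((Icc 1 M ×ˢ Icc 1 M) ×ˢ Icc 1 (2 * T)).image
      fun p => (2 * (p.1.1 : ℝ) - 1) * (2 * (p.1.2 : ℝ) - 1) * 2 ^ p.2 := by
    intro z hz
    obtain ⟨x, hx, y, hy, rfl⟩ := mem_mul.1 hz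
    obtain ⟨⟨m, n⟩, hp, rfl⟩ := mem_image.1 (hC hx)
    obtain ⟨⟨m', n'⟩, hp', rfl⟩ := mem_image.1 (hC hy)
    simp only [mem_product, mem_Icc] at hp hp'
    refine mem_image.2 ⟨((m, m'), n + n'), ?_, ?_⟩
    · simp only [mem_product, mem_Icc]
      omega
    · simp only [oddMulPow, pow_add]
      ring
  have h3 : #(C * C) ≤ 2 * M ^ 2 * T := by
    refine ((card_le_card h2).trans card_image_le).trans_eq ?_
    simp only [card_product, Nat.card_Icc, Nat.add_sub_cancel]
    ring
  calc #C ^ 4 = #C ^ 2 * #C ^ 2 := by ring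
    _ ≤ _ := h1
    _ ≤ _ := Nat.mul_le_mul_right _ h3

lemma min_le_max_energy (M T : ℕ) (hM : 1 ≤ M) (hT : 1 ≤ T) (B C : Finset ℝ)
    (h : IsDecomposition ((Icc 1 M ×ˢ Icc 1 T).image oddMulPow) B C) :
    min (M ^ 3 * T) (M ^ 2 * T ^ 3) ≤ 32 * max (addE B) (mulE C) := by
  obtain ⟨hd, hu⟩ := h
  have hcard := card_union_of_disjoint hd
  rw [← hu, card_image_oddMulPow] at hcard
  rcases le_total #C #B with hCB | hCB
  · have h1 := card_pow_four_le_addEnergy M T B (hu ▸ subset_union_left)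
    have h2 : (M * T) ^ 4 ≤ (2 * #B) ^ 4 := Nat.pow_le_pow_left (by omega) 4
    have h3 : (T ^ 3 * M) * (M ^ 3 * T) ≤ (T ^ 3 * M) * (32 * addEnergy B B) := by
      calc (T ^ 3 * M) * (M ^ 3 * T) = (M * T) ^ 4 := by ring
        _ ≤ (2 * #B) ^ 4 := h2
        _ = 16 * #B ^ 4 := by ring
        _ ≤ 16 * (2 * T ^ 3 * M * addEnergy B B) := Nat.mul_le_mul_left _ h1
        _ = _ := by ring
    have h4 := Nat.le_of_mul_le_mul_left h3 (by positivity)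
    exact (min_le_left _ _).trans (h4.trans (Nat.mul_le_mul_left _ (le_max_left _ _)))
  · have h1 := card_pow_four_le_mulEnergy M T C (hu ▸ subset_union_right)
    have h2 : (M * T) ^ 4 ≤ (2 * #C) ^ 4 := Nat.pow_le_pow_left (by omega) 4
    have h3 : (M ^ 2 * T) * (M ^ 2 * T ^ 3) ≤ (M ^ 2 * T) * (32 * mulEnergy C C) := by
      calc (M ^ 2 * T) * (M ^ 2 * T ^ 3) = (M * T) ^ 4 := by ring
        _ ≤ (2 * #C) ^ 4 := h2
        _ = 16 * #C ^ 4 := by ring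
        _ ≤ 16 * (2 * M ^ 2 * T * mulEnergy C C) := Nat.mul_le_mul_left _ h1
        _ = _ := by ring
    have h4 := Nat.le_of_mul_le_mul_left h3 (by positivity)
    exact (min_le_right _ _).trans (h4.trans (Nat.mul_le_mul_left _ (le_max_right _ _)))

lemma half_le_natFloor {x : ℝ} (hx : 1 ≤ x) : x / 2 ≤ ⌊x⌋₊ := by
  have h1 := Nat.lt_floor_add_one x
  have h2 : (1 : ℝ) ≤ ⌊x⌋₊ := by
    exact_mod_cast (Nat.one_le_floor_iff x).2 hx
  linarith

lemma exists_exampleSet_eq (N : ℕ) (hN : 1 ≤ N) : ∃ M T : ℕ, ∃ y : ℝ, 1 ≤ y ∧ y ^ 3 = N ∧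
    y ^ 2 / 2 ≤ M ∧ M ≤ y ^ 2 ∧ y / 2 ≤ T ∧ T ≤ y ∧ 1 ≤ M ∧ 1 ≤ T ∧
    exampleSet N = (Icc 1 M ×ˢ Icc 1 T).image oddMulPow := by
  have hN' : (1 : ℝ) ≤ N := by exact_mod_cast hN
  have hy : 1 ≤ (N : ℝ) ^ (1 / 3 : ℝ) := Real.one_le_rpow hN' (by norm_num)
  have hy2 : (N : ℝ) ^ (2 / 3 : ℝ) = ((N : ℝ) ^ (1 / 3 : ℝ)) ^ 2 := by
    rw [← Real.rpow_mul_natCast (by positivity)]; norm_num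
  have hy3 : ((N : ℝ) ^ (1 / 3 : ℝ)) ^ 3 = N := by
    rw [← Real.rpow_mul_natCast (by positivity)]; norm_num
  have h2 : 1 ≤ (N : ℝ) ^ (2 / 3 : ℝ) := Real.one_le_rpow hN' (by norm_num)
  refine ⟨⌊(N : ℝ) ^ (2 / 3 : ℝ)⌋₊, ⌊(N : ℝ) ^ (1 / 3 : ℝ)⌋₊, (N : ℝ) ^ (1 / 3 : ℝ), hy, hy3,
    ?_, ?_, half_le_natFloor hy, Nat.floor_le (by positivity), (Nat.one_le_floor_iff _).2 h2,
    (Nat.one_le_floor_iff _).2 hy, rfl⟩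
  · rw [← hy2]; exact half_le_natFloor h2
  · rw [← hy2]; exact Nat.floor_le (by positivity)

lemma tendsto_card_exampleSet :
    Filter.Tendsto (fun N : ℕ => #(exampleSet N)) Filter.atTop Filter.atTop := by
  rw [← tendsto_natCast_atTop_iff (R := ℝ)]
  refine Filter.tendsto_atTop_mono' _ (f₁ := fun N : ℕ => (N : ℝ) / 4) ?_
    (tendsto_natCast_atTop_atTop.atTop_div_const (by norm_num))
  filter_upwards [Filter.eventually_ge_atTop 1] with N hN
  obtain ⟨M, T, y, hy1, hy, hM, -, hT, -, -, -, hA⟩ := exists_exampleSet_eq N hN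
  rw [hA, card_image_oddMulPow, ← hy]
  push_cast
  calc (y ^ 3 / 4 : ℝ) = (y ^ 2 / 2) * (y / 2) := by ring
    _ ≤ (M : ℝ) * T := by gcongr

lemma exampleSet_energy_lower_bound (N : ℕ) (hN : 1 ≤ N) (B C : Finset ℝ)
    (h : IsDecomposition (exampleSet N) B C) :
    1 / 1024 * (#(exampleSet N) : ℝ) ^ (7 / 3 : ℝ) ≤ max (addE B : ℝ) (mulE C : ℝ) := by
  obtain ⟨M, T, y, hy1, hy, hM, hM', hT, hT', hM1, hT1, hA⟩ := exists_exampleSet_eq N hN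
  rw [hA] at h
  have h1 := min_le_max_energy M T hM1 hT1 B C h
  have h2 : min ((M : ℝ) ^ 3 * T) (M ^ 2 * T ^ 3) ≤ 32 * max (addE B : ℝ) (mulE C) := by
    exact_mod_cast h1
  have hy0 : 0 ≤ y := by linarith
  have hcard : (#(exampleSet N) : ℝ) ≤ y ^ 3 := by
    rw [hA, card_image_oddMulPow]
    push_cast
    calc (M : ℝ) * T ≤ y ^ 2 * y := by gcongr
      _ = y ^ 3 := by ring
  have h3 : (#(exampleSet N) : ℝ) ^ (7 / 3 : ℝ) ≤ y ^ 7 := by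
    calc (#(exampleSet N) : ℝ) ^ (7 / 3 : ℝ) ≤ (y ^ 3) ^ (7 / 3 : ℝ) := by gcongr
      _ = y ^ 7 := by
        rw [← Real.rpow_natCast_mul hy0]
        norm_num
  -- With M ≈ y² and T ≈ y both terms are of order y⁷, while |A_N| ≈ y³.
  have h4 : y ^ 7 / 32 ≤ min ((M : ℝ) ^ 3 * T) (M ^ 2 * T ^ 3) := by
    refine le_min ?_ ?_
    · have : (y ^ 2 / 2) ^ 3 * (y / 2) ≤ (M : ℝ) ^ 3 * T := by gcongr
      have h0 : 0 ≤ y ^ 7 := by positivity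
      nlinarith
    · have : (y ^ 2 / 2) ^ 2 * (y / 2) ^ 3 ≤ (M : ℝ) ^ 2 * T ^ 3 := by gcongr
      linarith [show (y ^ 2 / 2) ^ 2 * (y / 2) ^ 3 = y ^ 7 / 32 by ring]
  linarith

lemma third_le_of_permissible {β : ℝ} (h : Permissible β) : 1 / 3 ≤ β := by
  by_contra! hβ
  set ε := (1 / 3 - β) / 2 with hε
  have hε0 : 0 < ε := by linarith
  obtain ⟨K, hK⟩ := h ε hε0
  have ht : Filter.Tendsto (fun N : ℕ => (#(exampleSet N) : ℝ) ^ ε) Filter.atTop Filter.atTop :=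
    (tendsto_rpow_atTop hε0).comp (tendsto_natCast_atTop_atTop.comp tendsto_card_exampleSet)
  obtain ⟨N, hN1, hNK, hbig⟩ := ((Filter.eventually_ge_atTop 1).and
    ((tendsto_card_exampleSet.eventually_ge_atTop (max K 1)).and
      (ht.eventually_gt_atTop 1024))).exists
  obtain ⟨B, C, hBC, hle⟩ := hK (exampleSet N) ((le_max_left _ _).trans hNK)
  have hlow := (exampleSet_energy_lower_bound N hN1 B C hBC).trans hle
  have hpos : (0 : ℝ) < #(exampleSet N) := by
    exact_mod_cast lt_of_lt_of_le Nat.one_pos ((le_max_right K 1).trans hNK)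
  rw [show (7 / 3 : ℝ) = (2 + β + ε) + ε by rw [hε]; ring, Real.rpow_add hpos] at hlow
  have h0 : 0 < (#(exampleSet N) : ℝ) ^ (2 + β + ε) := by positivity
  nlinarith

/-! ### The decomposition and the upper bound 31/33 -/

/-- A set of large additive energy contains a nonempty set of nonzero reals of small
multiplicative energy; here `z` is the `396`-th root of the size of the ambient set. -/
lemma exists_subset_small_mulEnergy : ∃ z₀ : ℝ, 1 ≤ z₀ ∧ ∀ z : ℝ, z₀ ≤ z → ∀ B : Finset ℝ,
    (#B : ℝ) ≤ z ^ 396 → 1 + Real.log #B ≤ 397 * z → z ^ 1164 < addEnergy B B →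
    ∃ D ⊆ B, D.Nonempty ∧ (0 : ℝ) ∉ D ∧ (mulEnergy D D : ℝ) ≤ (1 / z ^ 105) ^ 4 * (#D : ℝ) ^ 4 := by
  obtain ⟨c, hc1, hc⟩ : ∃ c : ℝ, 1 ≤ c ∧ c = 3072 ^ 2 * 144 * 794 ^ 7 := ⟨_, by norm_num, rfl⟩
  refine ⟨324 * 397 * c ^ 2, by nlinarith, fun z hz B hB hlog hE => ?_⟩
  have hz1 : 1 ≤ z := by nlinarith
  have hz0 : 0 < z := by linarith
  -- One power of z and 794 = 2 · 397 pay for the logarithm. The exponent of z in n²⁰/W⁷ is then 396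
  -- · 20 - 1163 · 7 = -221.
  obtain ⟨D, hDB, hD0, hDD⟩ := exists_small_sumset B (W := z ^ 1163 / 794) hB (by positivity) (by
    calc 2 * (z ^ 1163 / 794) * (1 + Real.log #B) ≤ 2 * (z ^ 1163 / 794) * (397 * z) := by gcongr
      _ = z ^ 1164 := by rw [pow_succ z 1163]; ring
      _ < _ := hE)
  have hη : 3072 ^ 2 * 144 * (z ^ 396) ^ 20 / (z ^ 1163 / 794) ^ 7 = c / z ^ 221 := by
    rw [hc, div_pow, ← pow_mul, ← pow_mul, show 1163 * 7 = 396 * 20 + 221 by norm_num, pow_add]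
    field_simp
  rw [hη] at hDD
  have hcard0 : (0 : ℝ) < #D := by exact_mod_cast hD0.card_pos
  have hD3 : 3 ≤ #D := by
    have h1 : (#D : ℝ) ≤ #(D + D) := by exact_mod_cast card_le_card_add_left hD0
    have h2 : z ^ 221 * #D ≤ c * (#D : ℝ) ^ 2 := by
      have := h1.trans hDD
      rw [div_mul_eq_mul_div, le_div_iff₀ (by positivity)] at this
      linarith
    have h3 : z ≤ z ^ 221 := le_self_pow₀ hz1 (by norm_num)
    have h4 : z ^ 221 ≤ c * #D := by
      refine le_of_mul_le_mul_right ?_ hcard0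
      linarith
    have h5 : 3 * c ≤ z := by nlinarith
    have : (3 : ℝ) ≤ #D := by
      refine le_of_mul_le_mul_left ?_ (by linarith : 0 < c)
      linarith
    exact_mod_cast this
  obtain ⟨D', hD'D, hD'card, hsign⟩ := exists_large_signed_subset D hD3
  have hD'0 : D'.Nonempty := by rw [← card_pos]; omega
  refine ⟨D', hD'D.trans hDB, hD'0, ?_, ?_⟩
  · rcases hsign with h | h <;> exact fun h0 => lt_irrefl _ (h 0 h0)
  have hen : (mulEnergy D' D' : ℝ) ≤ 4 * (#(D' + D') : ℝ) ^ 2 * (1 + Real.log #D') := by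
    rcases hsign with h | h
    · exact mulEnergy_le_of_pos D' h
    · exact mulEnergy_le_of_neg D' h
  have hD'pos : (0 : ℝ) < #D' := by exact_mod_cast hD'0.card_pos
  have hlog' : 1 + Real.log #D' ≤ 397 * z := by
    have : Real.log #D' ≤ Real.log #B :=
      Real.log_le_log hD'pos (by exact_mod_cast card_le_card (hD'D.trans hDB))
    linarith
  have hlog0 : 0 ≤ 1 + Real.log #D' := by
    have : 0 ≤ Real.log #D' := Real.log_natCast_nonneg _
    linarith
  have hsum : (#(D' + D') : ℝ) ≤ 9 * (c / z ^ 221) * (#D' : ℝ) ^ 2 := by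
    have h1 : (#(D' + D') : ℝ) ≤ #(D + D) := by
      exact_mod_cast card_le_card (add_subset_add hD'D hD'D)
    have h2 : (#D : ℝ) ≤ 3 * #D' := by exact_mod_cast hD'card
    calc (#(D' + D') : ℝ) ≤ c / z ^ 221 * (#D : ℝ) ^ 2 := h1.trans hDD
      _ ≤ c / z ^ 221 * (3 * #D') ^ 2 := by gcongr
      _ = _ := by ring
  -- All constants and the logarithm fit into z²², because 442 = 4 · 105 + 22.
  have hzc : 324 * 397 * c ^ 2 * z ≤ z ^ 22 := by
    have h3 : z ≤ z ^ 21 := le_self_pow₀ hz1 (by norm_num)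
    calc 324 * 397 * c ^ 2 * z ≤ z ^ 21 * z := by gcongr; linarith
      _ = z ^ 22 := by ring
  calc (mulEnergy D' D' : ℝ) ≤ 4 * (#(D' + D') : ℝ) ^ 2 * (1 + Real.log #D') := hen
    _ ≤ 4 * (9 * (c / z ^ 221) * (#D' : ℝ) ^ 2) ^ 2 * (397 * z) := by gcongr
    _ = (324 * 397 * c ^ 2 * z) / z ^ 442 * (#D' : ℝ) ^ 4 := by
        rw [show 442 = 221 * 2 by norm_num, pow_mul]
        field_simp
        norm_num
    _ ≤ z ^ 22 / z ^ 442 * (#D' : ℝ) ^ 4 := by gcongr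
    _ = (1 / z ^ 105) ^ 4 * (#D' : ℝ) ^ 4 := by
        rw [show 442 = 105 * 4 + 22 by norm_num, pow_add, pow_mul]
        field_simp

lemma exists_decomposition : ∃ z₀ : ℝ, 1 ≤ z₀ ∧ ∀ z : ℝ, z₀ ≤ z → ∀ A : Finset ℝ,
    (#A : ℝ) ≤ z ^ 396 → 1 + Real.log #A ≤ 397 * z →
    ∃ B C : Finset ℝ, IsDecomposition A B C ∧
      (addE B : ℝ) ≤ z ^ 1164 ∧ (mulE C : ℝ) ≤ z ^ 1164 := by
  obtain ⟨z₀, hz₀, H⟩ := exists_subset_small_mulEnergy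
  refine ⟨z₀, hz₀, fun z hz A hA hlog => ?_⟩
  have hz0 : 0 < z := by linarith
  set θ := 1 / z ^ 105 with hθ
  have hθ0 : 0 ≤ θ := by positivity
  -- Zero is kept out of C, where quotients are needed; if it lies in A, it goes to B.
  set F := {C ∈ (A.erase 0).powerset | (mulEnergy C C : ℝ) ≤ θ ^ 4 * (#C : ℝ) ^ 4} with hF
  have hFne : F.Nonempty := ⟨∅, by simp [hF]⟩
  obtain ⟨C, hCF, hmax⟩ := F.exists_max_image card hFne
  have hCF' := mem_filter.1 hCF
  have hCA0 : C ⊆ A.erase 0 := mem_powerset.1 hCF'.1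
  have hCA : C ⊆ A := hCA0.trans (erase_subset _ _)
  have hC0 : (0 : ℝ) ∉ C := fun h => by simpa using hCA0 h
  refine ⟨A \ C, C, ⟨sdiff_disjoint, (sdiff_union_of_subset hCA).symm⟩, ?_, ?_⟩
  · by_contra! hcon
    have hBA : #(A \ C) ≤ #A := card_le_card sdiff_subset
    obtain ⟨D, hD, hDne, hD0, hDE⟩ := H z hz (A \ C)
      (le_trans (by exact_mod_cast hBA) hA) (by
        rcases Nat.eq_zero_or_pos #(A \ C) with h0 | h0
        · have := Real.log_natCast_nonneg #A
          rw [h0, Nat.cast_zero, Real.log_zero]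
          linarith
        · have : Real.log #(A \ C) ≤ Real.log #A :=
            Real.log_le_log (by exact_mod_cast h0) (by exact_mod_cast hBA)
          linarith) hcon
    have hCD : Disjoint C D := (disjoint_sdiff (s := C) (t := A)).mono_right hD
    have hmem : C ∪ D ∈ F := by
      refine mem_filter.2 ⟨mem_powerset.2 (union_subset hCA0 fun x hx => ?_),
        mulEnergy_disjUnion_le C D hC0 hD0 hCD hθ0 hCF'.2 hDE⟩
      exact mem_erase.2 ⟨fun h => hD0 (h ▸ hx), (mem_sdiff.1 (hD hx)).1⟩
    have h1 := hmax _ hmem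
    rw [card_union_of_disjoint hCD] at h1
    have := hDne.card_pos
    omega
  · have hCc : (#C : ℝ) ≤ z ^ 396 := le_trans (by exact_mod_cast card_le_card hCA) hA
    calc (mulE C : ℝ) ≤ θ ^ 4 * (#C : ℝ) ^ 4 := hCF'.2
      _ ≤ θ ^ 4 * (z ^ 396) ^ 4 := by gcongr
      _ = z ^ 1164 := by
        rw [hθ, ← pow_mul, show 396 * 4 = 105 * 4 + 1164 by norm_num, pow_add, pow_mul]
        field_simp

lemma permissible_thirtyOne_div_thirtyThree : Permissible (31 / 33) := by
  intro ε hε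
  obtain ⟨z₀, hz₀, H⟩ := exists_decomposition
  have ht : Filter.Tendsto (fun n : ℕ => (n : ℝ) ^ (1 / 396 : ℝ)) Filter.atTop Filter.atTop :=
    (tendsto_rpow_atTop (by norm_num)).comp tendsto_natCast_atTop_atTop
  obtain ⟨K, hK⟩ := Filter.eventually_atTop.1 (ht.eventually_ge_atTop z₀)
  refine ⟨max K 1, fun A hAK => ?_⟩
  have hz := hK #A ((le_max_left _ _).trans hAK)
  have hA1 : (1 : ℝ) ≤ #A := by exact_mod_cast (le_max_right K 1).trans hAK
  have hA0 : (0 : ℝ) ≤ #A := by linarith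
  obtain ⟨B, C, hBC, h1, h2⟩ := H _ hz A
    (by rw [← Real.rpow_mul_natCast hA0]; norm_num)
    (by
      -- This gives log|A| ≤ 396z; the extra 1 is at most z. Also 1164/396 = 2 + 31/33.
      have h3 := Real.log_le_rpow_div hA0 (ε := 1 / 396) (by norm_num)
      have h4 := hz₀.trans hz
      linarith)
  refine ⟨B, C, hBC, (max_le h1 h2).trans ?_⟩
  rw [← Real.rpow_mul_natCast hA0]
  refine Real.rpow_le_rpow_of_exponent_le hA1 ?_
  norm_num
  linarith

end LowEnergy

theorem theorem1p2 :
    (∃ κ : ℝ, IsGLB {β : ℝ | LowEnergy.Permissible β} κ ∧ 1 / 3 ≤ κ ∧ κ ≤ 31 / 33) ∧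
    Filter.Tendsto (fun N : ℕ => (LowEnergy.exampleSet N).card) Filter.atTop Filter.atTop ∧
    (∃ c : ℝ, 0 < c ∧ ∀ N : ℕ, 1 ≤ N → ∀ B C : Finset ℝ,
      LowEnergy.IsDecomposition (LowEnergy.exampleSet N) B C →
        c * ((LowEnergy.exampleSet N).card : ℝ) ^ (7 / 3 : ℝ) ≤
          max (LowEnergy.addE B : ℝ) (LowEnergy.mulE C : ℝ)) := by
  have hlow : (1 / 3 : ℝ) ∈ lowerBounds {β : ℝ | LowEnergy.Permissible β} :=
    fun β hβ => LowEnergy.third_le_of_permissible hβ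
  have hmem : (31 / 33 : ℝ) ∈ {β : ℝ | LowEnergy.Permissible β} :=
    LowEnergy.permissible_thirtyOne_div_thirtyThree
  have hglb := isGLB_csInf ⟨_, hmem⟩ ⟨_, hlow⟩
  exact ⟨⟨_, hglb, hglb.2 hlow, hglb.1 hmem⟩, LowEnergy.tendsto_card_exampleSet, 1 / 1024,
    by norm_num, LowEnergy.exampleSet_energy_lower_bound⟩
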